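/- A convex body in $\mathbb{R}^m$ is a compact convex set with nonempty interior. A normal of a convex body $K\subset\mathbb{R}^m$ is a half-line that starts at a boundary point $q$ of $K$, is perpendicular to a supporting hyperplane of $K$ at $q$, and points to the side of this hyperplane on which $K$ lies. For $p\in K$ let $n(K,p)\in\{0,1,2,\dots\}\cup\{\infty\}$ be the number of normals of $K$ passing through $p$, and let $$n(K)=\frac{1}{\operatorname{vol}(K)}\int_{K} n(K,p)\,dp\in[0,\infty]$$ be the average number of normals through a point of $K$, where $\operatorname{vol}$ is $m$-dimensional Lebesgue measure. (1) Let $K\subset\mathbb{R}^m$ be a convex body whose boundary is a hypersurface of class $C^2$. If $n(K)=2$, then $K$ is a Euclidean ball. (2) Let $m\ge 2$, and let $P\subset\mathbb{R}^m$ be a convex polytope with nonempty interior. Then $n(P)>2$. -/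

import Mathlib

open MeasureTheory Filter Topology
open scoped ENNReal

/-- A convex body of `ℝ^m`: a compact convex set with nonempty interior. -/
structure IsConvexBody {m : ℕ} (K : Set (EuclideanSpace ℝ (Fin m))) : Prop where
  convex : Convex ℝ K
  isCompact : IsCompact K
  nonempty_interior : (interior K).Nonempty

/-- A convex polytope: the convex hull of a finite set of points. -/
def IsConvexPolytope {m : ℕ} (P : Set (EuclideanSpace ℝ (Fin m))) : Prop :=
  ∃ V : Set (EuclideanSpace ℝ (Fin m)), V.Finite ∧ P = convexHull ℝ V

/-- The boundary of `K` is a hypersurface of class `C²`: near each of its points it is the zero set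
of a `C²` function with nonvanishing derivative. -/
def HasC2Boundary {m : ℕ} (K : Set (EuclideanSpace ℝ (Fin m))) : Prop :=
  ∀ q ∈ frontier K, ∃ f : EuclideanSpace ℝ (Fin m) → ℝ,
    ContDiffAt ℝ 2 f q ∧ fderiv ℝ f q ≠ 0 ∧ ∀ᶠ x in 𝓝 q, (x ∈ frontier K ↔ f x = 0)

/-- `u` is an inner normal vector, at the point `q`, of a supporting hyperplane of `K`: the
hyperplane through `q` orthogonal to `u ≠ 0` has `K` on the side to which `u` points. -/
def IsInnerNormalVector {m : ℕ} (K : Set (EuclideanSpace ℝ (Fin m)))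
    (q u : EuclideanSpace ℝ (Fin m)) : Prop :=
  u ≠ 0 ∧ ∀ x ∈ K, 0 ≤ inner ℝ u (x - q)

/-- The half-line `{q + t u : t ≥ 0}` starting at `q` in the direction `u`. -/
def halfLine {m : ℕ} (q u : EuclideanSpace ℝ (Fin m)) : Set (EuclideanSpace ℝ (Fin m)) :=
  {p | ∃ t : ℝ, 0 ≤ t ∧ p = q + t • u}

/-- The set of all normals of `K`: the half-lines that start at a boundary point `q` of `K` and
are perpendicular to a supporting hyperplane of `K` at `q` (on the side of `K`). -/
def normals {m : ℕ} (K : Set (EuclideanSpace ℝ (Fin m))) :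
    Set (Set (EuclideanSpace ℝ (Fin m))) :=
  {L | ∃ q ∈ frontier K, ∃ u, IsInnerNormalVector K q u ∧ L = halfLine q u}

/-- `n(K, p)`: the number, possibly infinite, of normals of `K` passing through `p`. -/
noncomputable def numNormals {m : ℕ} (K : Set (EuclideanSpace ℝ (Fin m)))
    (p : EuclideanSpace ℝ (Fin m)) : ℕ∞ :=
  {L ∈ normals K | p ∈ L}.encard

/-- `n(K) = (1 / vol K) ∫_K n(K, p) dp`: the average number of normals through a point of `K`,
an element of `[0, ∞]`. -/
noncomputable def avgNormals {m : ℕ} (K : Set (EuclideanSpace ℝ (Fin m))) : ℝ≥0∞ :=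
  (∫⁻ p in K, (numNormals K p : ℝ≥0∞)) / volume K

/-! Through an interior point `p` of `K` pass the normals from a nearest and from a farthest
boundary point; these feet differ unless `K` is a ball centred at `p`. So for a body other than a
ball `n(K, p) ≥ 2` on the interior, and an open set of points with three normals makes the average
exceed 2.

Such a set lies just beyond an incenter `c`. Let `q` be a contact point of the maximal inscribed
ball, and push `c` slightly away from `q` to `p₁`. No point of `K` is farther from the boundary than
`c`, so `q` is no longer nearest to `p₁`; by continuity it is not farthest either. The normal at `q`
is thus a third one. If `p₁` is not focal for `q`, which excludes finitely many positions, this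
normal persists near `p₁` (`eventually_exists_eq_add_smul_gradient`).

Only smoothness near `q` is used (`IsIncenter.two_lt_avgNormals`). A polytope has it as well, being
flat near a contact point. -/

/-! ### Normals through interior points of a convex body. -/

section ConvexGeometry

variable {m : ℕ} {K : Set (EuclideanSpace ℝ (Fin m))}

/-- A half-line determines its initial point. -/
theorem halfLine_injOn (p : EuclideanSpace ℝ (Fin m)) :
    Set.InjOn (fun q => halfLine q (p - q)) {q | p - q ≠ 0} := by
  intro q hq q' hq' h
  set u := p - q with hu
  set u' := p - q' with hu'
  have h' : halfLine q u = halfLine q' u' := h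
  have mem : ∀ {a v : EuclideanSpace ℝ (Fin m)} {t : ℝ}, 0 ≤ t → a + t • v ∈ halfLine a v :=
    fun ht => ⟨_, ht, rfl⟩
  obtain ⟨t₀, ht₀, e₀⟩ : q ∈ halfLine q' u' := by
    rw [← h']; simpa using mem (a := q) (v := u) le_rfl
  obtain ⟨s, hs, es⟩ : q' ∈ halfLine q u := by
    rw [h']; simpa using mem (a := q') (v := u') le_rfl
  have e₁ : u = (1 - t₀) • u' := by
    rw [sub_smul, one_smul, hu, hu']
    nth_rewrite 1 [e₀]
    abel
  -- If the directions were opposite, a far point of the first half-line would lie behind `q'`.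
  have hc : 0 < 1 - t₀ := by
    by_contra hneg
    have hne : 1 - t₀ ≠ 0 := fun h0 => hq (by change u = 0; rw [e₁, h0, zero_smul])
    have hlt : 1 - t₀ < 0 := lt_of_le_of_ne (not_lt.1 hneg) hne
    obtain ⟨n, hn⟩ := exists_nat_gt (t₀ / -(1 - t₀))
    rw [div_lt_iff₀ (by linarith)] at hn
    obtain ⟨t, ht, e⟩ : q + (n : ℝ) • u ∈ halfLine q' u' := by
      rw [← h']; exact mem (Nat.cast_nonneg n)
    have h3 : (t - t₀ - n * (1 - t₀)) • u' = 0 := by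
      have : q' + t₀ • u' + (n : ℝ) • ((1 - t₀) • u') = q' + t • u' := by
        rw [← e₀, ← e₁, e]
      have h4 : t • u' = t₀ • u' + (n : ℝ) • ((1 - t₀) • u') := by
        rw [add_assoc] at this
        exact (add_left_cancel this).symm
      rw [sub_smul, sub_smul, mul_smul, h4]; abel
    rcases smul_eq_zero.1 h3 with h5 | h5
    · nlinarith
    · exact hq' h5
  have h6 : (t₀ + s * (1 - t₀)) • u' = 0 := by
    have : q = q + s • ((1 - t₀) • u') + t₀ • u' := by
      rw [← e₁, ← es]; exact e₀
    have h7 : s • ((1 - t₀) • u') + t₀ • u' = 0 := by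
      rw [add_assoc] at this
      exact left_eq_add.1 this
    rw [add_smul, mul_smul, add_comm]; exact h7
  rcases smul_eq_zero.1 h6 with h7 | h7
  · have : t₀ = 0 := by nlinarith [mul_nonneg hs hc.le]
    rw [e₀, this, zero_smul, add_zero]
  · exact absurd h7 hq'

/-- Points of the boundary from which `p` is seen along an inner normal give normals through `p`. -/
theorem encard_le_numNormals {p : EuclideanSpace ℝ (Fin m)} {Q : Set (EuclideanSpace ℝ (Fin m))}
    (hQ : ∀ q ∈ Q, q ∈ frontier K ∧ IsInnerNormalVector K q (p - q)) :
    Q.encard ≤ numNormals K p := by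
  have hinj : Set.InjOn (fun q => halfLine q (p - q)) Q :=
    (halfLine_injOn p).mono fun q hq => (hQ q hq).2.1
  rw [← hinj.encard_image]
  refine Set.encard_le_encard ?_
  rintro _ ⟨q, hq, rfl⟩
  exact ⟨⟨q, (hQ q hq).1, p - q, (hQ q hq).2, rfl⟩, 1, zero_le_one, by simp⟩

theorem numNormals_eq_zero_of_frontier_eq_empty (h : frontier K = ∅)
    (p : EuclideanSpace ℝ (Fin m)) : numNormals K p = 0 := by
  simp [numNormals, normals, h]

theorem IsConvexBody.frontier_eq (hK : IsConvexBody K) : frontier K = K \ interior K :=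
  hK.isCompact.isClosed.frontier_eq

theorem IsConvexBody.frontier_subset (hK : IsConvexBody K) : frontier K ⊆ K :=
  hK.isCompact.isClosed.frontier_subset

theorem IsConvexBody.exists_isInnerNormalVector (hK : IsConvexBody K)
    {x : EuclideanSpace ℝ (Fin m)} (hx : x ∈ frontier K) : ∃ u, IsInnerNormalVector K x u := by
  have hxi : x ∉ interior K := (hK.frontier_eq ▸ hx).2
  obtain ⟨f, hf⟩ := geometric_hahn_banach_open_point hK.convex.interior isOpen_interior hxi
  obtain ⟨a, ha⟩ := hK.nonempty_interior
  refine ⟨-(InnerProductSpace.toDual ℝ _).symm f, ?_, ?_⟩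
  · intro h0
    have : f = 0 := by simpa using h0
    have := hf a ha
    simp_all
  · have hsub : K ⊆ closure (interior K) := by
      rw [hK.convex.closure_interior_eq_closure_of_nonempty_interior hK.nonempty_interior]
      exact subset_closure
    intro y hy
    rw [inner_neg_left, InnerProductSpace.toDual_symm_apply, map_sub]
    have hle : ∀ z ∈ closure (interior K), f z ≤ f x :=
      closure_minimal (fun z hz => (hf z hz).le) (isClosed_le f.continuous continuous_const)
    linarith [hle y (hsub hy)]

/-- The ball is connected, meets the interior and misses the frontier, so it cannot reach the
complement. -/
theorem ball_subset_interior_of_le_dist_frontier {p : EuclideanSpace ℝ (Fin m)} {r : ℝ}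
    (hK : IsClosed K) (hp : p ∈ interior K) (h : ∀ y ∈ frontier K, r ≤ dist p y) :
    Metric.ball p r ⊆ interior K := by
  rcases le_or_gt r 0 with hr | hr
  · simp [Metric.ball_eq_empty.2 hr]
  refine (convex_ball p r).isPreconnected.subset_left_of_subset_union isOpen_interior
    hK.isOpen_compl ?_ ?_ ⟨p, Metric.mem_ball_self hr, hp⟩
  · exact (disjoint_compl_right.mono_left interior_subset)
  · intro y hy
    by_cases hyK : y ∈ K
    · left
      by_contra hyi
      have := h y (hK.frontier_eq ▸ ⟨hyK, hyi⟩)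
      rw [dist_comm] at this
      exact absurd (Metric.mem_ball.1 hy) (not_lt.2 this)
    · exact Or.inr hyK

theorem closedBall_subset_of_le_dist_frontier {p : EuclideanSpace ℝ (Fin m)} {r : ℝ} (hr : 0 < r)
    (hK : IsClosed K) (hp : p ∈ interior K) (h : ∀ y ∈ frontier K, r ≤ dist p y) :
    Metric.closedBall p r ⊆ K := by
  rw [← closure_ball p hr.ne']
  exact closure_minimal ((ball_subset_interior_of_le_dist_frontier hK hp h).trans interior_subset) hK

theorem dist_pos_of_mem_interior_of_mem_frontier {p q : EuclideanSpace ℝ (Fin m)}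
    (hp : p ∈ interior K) (hq : q ∈ frontier K) : 0 < dist p q :=
  dist_pos.2 fun h => disjoint_interior_frontier.le_bot ⟨hp, h ▸ hq⟩

/-- At a boundary point touched by an inner ball centred at `p`, the inner normal is unique. -/
theorem IsInnerNormalVector.smul_eq_of_nearest {p q u : EuclideanSpace ℝ (Fin m)}
    (hu : IsInnerNormalVector K q u) (hK : IsClosed K) (hp : p ∈ interior K) (hq : q ∈ frontier K)
    (h : ∀ y ∈ frontier K, dist p q ≤ dist p y) : ‖p - q‖ • u = ‖u‖ • (p - q) := by
  have hr := dist_pos_of_mem_interior_of_mem_frontier hp hq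
  have hun : 0 < ‖u‖ := norm_pos_iff.2 hu.1
  rw [← inner_eq_norm_mul_iff_real]
  refine le_antisymm (real_inner_le_norm _ _) ?_
  -- The lowest point of the inner ball in direction `u`; the support inequality there is the
  -- reverse of Cauchy–Schwarz.
  have hmem : p - (dist p q / ‖u‖) • u ∈ K := by
    refine closedBall_subset_of_le_dist_frontier hr hK hp h ?_
    rw [Metric.mem_closedBall, dist_eq_norm, sub_sub_cancel_left, norm_neg, norm_smul,
      Real.norm_of_nonneg (by positivity), div_mul_cancel₀ _ hun.ne']
  have := hu.2 _ hmem
  rw [sub_right_comm, inner_sub_right, inner_smul_right, real_inner_self_eq_norm_sq] at this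
  have e : dist p q / ‖u‖ * ‖u‖ ^ 2 = ‖u‖ * ‖p - q‖ := by
    rw [dist_eq_norm]; field_simp
  linarith

theorem IsConvexBody.isInnerNormalVector_of_nearest (hK : IsConvexBody K)
    {p q : EuclideanSpace ℝ (Fin m)} (hp : p ∈ interior K) (hq : q ∈ frontier K)
    (h : ∀ y ∈ frontier K, dist p q ≤ dist p y) : IsInnerNormalVector K q (p - q) := by
  obtain ⟨u, hu⟩ := hK.exists_isInnerNormalVector hq
  have e := hu.smul_eq_of_nearest hK.isCompact.isClosed hp hq h
  have hr : 0 < ‖p - q‖ := by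
    rw [← dist_eq_norm]; exact dist_pos_of_mem_interior_of_mem_frontier hp hq
  have hun : 0 < ‖u‖ := norm_pos_iff.2 hu.1
  refine ⟨norm_pos_iff.1 hr, fun x hx => ?_⟩
  have h1 : 0 ≤ ‖p - q‖ * inner ℝ u (x - q) := mul_nonneg hr.le (hu.2 x hx)
  rw [← real_inner_smul_left, e, real_inner_smul_left] at h1
  exact nonneg_of_mul_nonneg_right h1 hun

theorem isInnerNormalVector_of_farthest
    {p q : EuclideanSpace ℝ (Fin m)} (hne : p ≠ q)
    (h : ∀ y ∈ K, dist p y ≤ dist p q) : IsInnerNormalVector K q (p - q) := by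
  refine ⟨sub_ne_zero.2 hne, fun x hx => ?_⟩
  have h1 := h x hx
  rw [dist_eq_norm, dist_eq_norm] at h1
  have h2 : ‖p - x‖ ^ 2 ≤ ‖p - q‖ ^ 2 := by gcongr
  have h3 : p - x = (p - q) - (x - q) := by abel
  rw [h3, norm_sub_sq_real] at h2
  nlinarith [sq_nonneg ‖x - q‖]

theorem IsInnerNormalVector.inner_pos_of_mem_interior {p q u : EuclideanSpace ℝ (Fin m)}
    (hu : IsInnerNormalVector K q u) (hp : p ∈ interior K) : 0 < inner ℝ u (p - q) := by
  have hcont : Tendsto (fun t : ℝ => p - t • u) (𝓝[>] 0) (𝓝 p) := by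
    have : Continuous fun t : ℝ => p - t • u := by fun_prop
    simpa using (this.tendsto 0).mono_left nhdsWithin_le_nhds
  obtain ⟨t, ht, ht0⟩ := ((hcont.eventually_mem (isOpen_interior.mem_nhds hp)).and
    self_mem_nhdsWithin).exists
  have h1 := hu.2 _ (interior_subset ht)
  rw [sub_right_comm, inner_sub_right, inner_smul_right, real_inner_self_eq_norm_sq] at h1
  have : 0 < ‖u‖ := norm_pos_iff.2 hu.1
  have ht0' : 0 < t := ht0
  have : 0 < t * ‖u‖ ^ 2 := by positivity
  linarith

theorem IsConvexBody.mem_frontier_of_isInnerNormalVector (hK : IsConvexBody K)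
    {q u : EuclideanSpace ℝ (Fin m)} (hq : q ∈ K) (hu : IsInnerNormalVector K q u) :
    q ∈ frontier K := by
  rw [hK.frontier_eq]
  refine ⟨hq, fun hi => ?_⟩
  simpa using hu.inner_pos_of_mem_interior hi

/-- Through an interior point of a convex body other than a ball there pass two normals, starting
at a nearest and at a farthest boundary point, at different distances. -/
theorem IsConvexBody.exists_nearest_farthest (hK : IsConvexBody K) (hf : (frontier K).Nonempty)
    (hball : ¬ ∃ (c : EuclideanSpace ℝ (Fin m)) (r : ℝ), 0 < r ∧ K = Metric.closedBall c r)
    {p : EuclideanSpace ℝ (Fin m)} (hp : p ∈ interior K) :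
    ∃ a b, (a ∈ frontier K ∧ IsInnerNormalVector K a (p - a)) ∧
      (b ∈ frontier K ∧ IsInnerNormalVector K b (p - b)) ∧ dist p a < dist p b ∧
      (∀ y ∈ frontier K, dist p a ≤ dist p y) ∧ ∀ y ∈ K, dist p y ≤ dist p b := by
  have hfc : IsCompact (frontier K) := hK.isCompact.of_isClosed_subset isClosed_frontier
    hK.frontier_subset
  have hcont : Continuous fun y => dist p y := by fun_prop
  obtain ⟨a, ha, hamin⟩ := hfc.exists_isMinOn hf hcont.continuousOn
  obtain ⟨b, hb, hbmax⟩ := hK.isCompact.exists_isMaxOn ⟨p, interior_subset hp⟩ hcont.continuousOn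
  have ha' : ∀ y ∈ frontier K, dist p a ≤ dist p y := fun y hy => hamin hy
  have hb' : ∀ y ∈ K, dist p y ≤ dist p b := fun y hy => hbmax hy
  have hapos := dist_pos_of_mem_interior_of_mem_frontier hp ha
  have hab := hb' a (hK.frontier_subset ha)
  have hbn : IsInnerNormalVector K b (p - b) :=
    isInnerNormalVector_of_farthest (dist_pos.1 (hapos.trans_le hab)) hb'
  refine ⟨a, b, ⟨ha, hK.isInnerNormalVector_of_nearest hp ha ha'⟩,
    ⟨hK.mem_frontier_of_isInnerNormalVector hb hbn, hbn⟩, lt_of_le_of_ne hab fun heq => ?_, ha', hb'⟩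
  -- Equal extreme distances squeeze `K` between a ball and itself.
  refine hball ⟨p, dist p a, hapos, Set.Subset.antisymm (fun y hy => ?_)
    (closedBall_subset_of_le_dist_frontier hapos hK.isCompact.isClosed hp ha')⟩
  rw [Metric.mem_closedBall, dist_comm, heq]
  exact hb' y hy

theorem IsConvexBody.two_le_numNormals (hK : IsConvexBody K) (hf : (frontier K).Nonempty)
    (hball : ¬ ∃ (c : EuclideanSpace ℝ (Fin m)) (r : ℝ), 0 < r ∧ K = Metric.closedBall c r)
    {p : EuclideanSpace ℝ (Fin m)} (hp : p ∈ interior K) : 2 ≤ numNormals K p := by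
  obtain ⟨a, b, ha, hb, hlt, -⟩ := hK.exists_nearest_farthest hf hball hp
  have hne : a ≠ b := fun h => (h ▸ hlt).ne rfl
  rw [← Set.encard_pair hne]
  refine encard_le_numNormals ?_
  rintro q (rfl | rfl)
  exacts [ha, hb]

/-- A foot at a distance strictly between the extremes is neither nearest nor farthest; `a₁` and
`b₁` are only witnesses and need not be feet of normals. -/
theorem IsConvexBody.three_le_numNormals (hK : IsConvexBody K)
    (hball : ¬ ∃ (c : EuclideanSpace ℝ (Fin m)) (r : ℝ), 0 < r ∧ K = Metric.closedBall c r)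
    {p x a₁ b₁ : EuclideanSpace ℝ (Fin m)} (hp : p ∈ interior K) (hx : x ∈ frontier K)
    (hxn : IsInnerNormalVector K x (p - x)) (ha₁ : a₁ ∈ frontier K) (hb₁ : b₁ ∈ K)
    (h₁ : dist p a₁ < dist p x) (h₂ : dist p x < dist p b₁) : 3 ≤ numNormals K p := by
  obtain ⟨a, b, ha, hb, hlt, hmin, hmax⟩ := hK.exists_nearest_farthest ⟨x, hx⟩ hball hp
  have hax : dist p a < dist p x := (hmin a₁ ha₁).trans_lt h₁
  have hxb : dist p x < dist p b := h₂.trans_le (hmax b₁ hb₁)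
  have h3 : ({a, x, b} : Set (EuclideanSpace ℝ (Fin m))).encard = 3 :=
    Set.encard_eq_three.2 ⟨a, x, b, fun h => (h ▸ hax).ne rfl, fun h => (h ▸ hlt).ne rfl,
      fun h => (h ▸ hxb).ne rfl, rfl⟩
  rw [← h3]
  refine encard_le_numNormals ?_
  rintro q (rfl | rfl | rfl)
  exacts [ha, ⟨hx, hxn⟩, hb]

/-- If every interior point lies on two normals, and the points of a nonempty open set lie on
three, then the average number of normals exceeds two. -/
theorem IsConvexBody.two_lt_avgNormals (hK : IsConvexBody K)
    (h2 : ∀ p ∈ interior K, 2 ≤ numNormals K p) {O : Set (EuclideanSpace ℝ (Fin m))}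
    (hO : IsOpen O) (hOne : O.Nonempty) (hOK : O ⊆ interior K)
    (h3 : ∀ p ∈ O, 3 ≤ numNormals K p) : 2 < avgNormals K := by
  have hvol : volume K = volume (interior K) :=
    (measure_congr (interior_ae_eq_of_null_frontier (hK.convex.addHaar_frontier volume))).symm
  have hfin : volume K ≠ ⊤ := hK.isCompact.measure_lt_top.ne
  have hpos : 0 < volume O := hO.measure_pos volume hOne
  have hKpos : volume K ≠ 0 :=
    (hvol ▸ isOpen_interior.measure_pos volume hK.nonempty_interior).ne'
  rw [avgNormals, ENNReal.lt_div_iff_mul_lt (Or.inl hKpos) (Or.inl hfin)]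
  calc 2 * volume K < 2 * volume (interior K) + volume O := by
        rw [← hvol]
        exact ENNReal.lt_add_right (ENNReal.mul_ne_top (by simp) hfin) hpos.ne'
    _ = ∫⁻ p in interior K, (2 + O.indicator 1 p) := by
        rw [lintegral_add_left measurable_const, lintegral_indicator_one hO.measurableSet]
        simp [Measure.restrict_apply hO.measurableSet, Set.inter_eq_left.2 hOK]
    _ ≤ ∫⁻ p in interior K, (numNormals K p : ℝ≥0∞) := by
        refine setLIntegral_mono' measurableSet_interior fun p hp => ?_
        by_cases hpO : p ∈ O
        · have := ENat.toENNReal_le.2 (h3 p hpO)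
          simp only [hpO, Set.indicator_of_mem, Pi.one_apply]
          convert this using 1
          norm_num
        · have := ENat.toENNReal_le.2 (h2 p hp)
          simpa [hpO] using this
    _ ≤ ∫⁻ p in K, (numNormals K p : ℝ≥0∞) := lintegral_mono_set interior_subset

end ConvexGeometry

/-- A pencil of endomorphisms through an injective one is surjective at all but finitely many
parameters. -/
theorem LinearMap.finite_setOf_not_surjective_add_smul {V : Type*} [AddCommGroup V] [Module ℝ V]
    [FiniteDimensional ℝ V] (A B : V →ₗ[ℝ] V) (hA : Function.Injective A) :
    {t : ℝ | ¬ Function.Surjective (A + t • B)}.Finite := by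
  let e : V ≃ₗ[ℝ] V := LinearEquiv.ofInjectiveEndo A hA
  -- A kernel vector of `A + t • B` is an eigenvector of `A⁻¹B` with eigenvalue `-1/t`.
  have hfin := (Module.End.finite_hasEigenvalue (e.symm.toLinearMap ∘ₗ B)).preimage
    (f := fun t : ℝ => -t⁻¹) (fun a _ b _ h => inv_injective (neg_injective h))
  refine hfin.subset fun t ht => ?_
  rw [Set.mem_ofPred_eq, ← LinearMap.injective_iff_surjective, injective_iff_map_eq_zero] at ht
  push Not at ht
  obtain ⟨v, hv, hv0⟩ := ht
  have hv' : A v + t • B v = 0 := hv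
  have ht0 : t ≠ 0 := by
    rintro rfl
    rw [zero_smul, add_zero] at hv'
    exact hv0 (hA (by rw [hv', map_zero]))
  refine Module.End.hasEigenvalue_of_hasEigenvector (x := v)
    ⟨Module.End.mem_eigenspace_iff.2 ?_, hv0⟩
  rw [LinearMap.comp_apply, LinearEquiv.coe_coe, LinearEquiv.symm_apply_eq]
  change B v = A (-t⁻¹ • v)
  rw [map_smul, eq_neg_of_add_eq_zero_left hv', smul_neg, neg_smul, neg_neg,
    inv_smul_smul₀ ht0]

/-! ### Focal points, incenters and persistence of a normal at a `C²` boundary point. -/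

section LocallySmooth

variable {m : ℕ} {K : Set (EuclideanSpace ℝ (Fin m))} {f : EuclideanSpace ℝ (Fin m) → ℝ}

/-- An inner normal at a boundary point is parallel to the gradient of a defining function. -/
theorem IsInnerNormalVector.exists_gradient_eq_smul {x u : EuclideanSpace ℝ (Fin m)}
    (hu : IsInnerNormalVector K x u) (hK : IsConvexBody K) (hx : x ∈ frontier K)
    (hf : HasStrictFDerivAt f (fderiv ℝ f x) x) (hf0 : fderiv ℝ f x ≠ 0)
    (hfK : ∀ᶠ y in 𝓝 x, (y ∈ frontier K ↔ f y = 0)) :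
    ∃ k : ℝ, k ≠ 0 ∧ gradient f x = k • u := by
  have hfx : f x = 0 := hfK.self_of_nhds.1 hx
  have hφ : HasStrictFDerivAt (fun y => innerSL ℝ u y) (innerSL ℝ u) x :=
    (innerSL ℝ u).hasStrictFDerivAt
  -- Lagrange multipliers: a supporting functional is minimal at `x` on the level set.
  have hmin : IsLocalMinOn (fun y => innerSL ℝ u y) {y | f y = f x} x := by
    refine eventually_nhdsWithin_iff.2 ?_
    filter_upwards [hfK] with y hy hyf
    have := hu.2 y (hK.frontier_subset (hy.2 (hyf.trans hfx)))
    rw [inner_sub_right] at this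
    simpa using sub_nonneg.1 this
  obtain ⟨a, b, hab, e⟩ :=
    IsLocalExtrOn.exists_multipliers_of_hasStrictFDerivAt_1d (Or.inl hmin) hf hφ
  have hu0 : innerSL ℝ u ≠ 0 := fun h => hu.1 (by
    have := congrArg (fun l => l u) h
    simpa using this)
  have ha : a ≠ 0 := by
    rintro rfl
    rw [zero_smul, zero_add] at e
    rcases smul_eq_zero.1 e with h | h
    · exact hab (by rw [h]; rfl)
    · exact hu0 h
  have hb : b ≠ 0 := by
    rintro rfl
    rw [zero_smul, add_zero] at e
    rcases smul_eq_zero.1 e with h | h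
    · exact hab (by rw [h]; rfl)
    · exact hf0 h
  refine ⟨-(b / a), neg_ne_zero.2 (div_ne_zero hb ha), ?_⟩
  rw [gradient, LinearIsometryEquiv.symm_apply_eq]
  ext y
  have := congrArg (fun l => l y) e
  simp only [_root_.add_apply, _root_.smul_apply, innerSL_apply_apply,
    smul_eq_mul, _root_.zero_apply] at this
  rw [InnerProductSpace.toDual_apply_apply, real_inner_smul_left]
  field_simp
  linarith

/-- If `q` is not a focal point of `q + t ∇f(q)`, then all points near `q + t ∇f(q)` are of the
form `x + s ∇f(x)`, with `x` near `q` on the level set of `f` and `s` near `t`. -/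
theorem eventually_exists_eq_add_smul_gradient {q : EuclideanSpace ℝ (Fin m)}
    (hf : ContDiffAt ℝ 2 f q) (hf0 : fderiv ℝ f q ≠ 0) (hfq : f q = 0) :
    ∃ S : Set ℝ, S.Finite ∧ ∀ t ∉ S, ∀ P : EuclideanSpace ℝ (Fin m) × ℝ → Prop,
      (∀ᶠ z in 𝓝 (q, t), P z) → ∀ᶠ p in 𝓝 (q + t • gradient f q),
        ∃ z, P z ∧ f z.1 = 0 ∧ z.1 + z.2 • gradient f z.1 = p := by
  have hg : ContDiffAt ℝ 1 (gradient f) q :=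
    ((InnerProductSpace.toDual ℝ (EuclideanSpace ℝ (Fin m))).symm.contDiff.contDiffAt).comp q
      (hf.fderiv_right (m := 1) (by norm_num))
  set g := gradient f q with hgdef
  set H := fderiv ℝ (gradient f) q with hH
  have hgs : HasStrictFDerivAt (gradient f) H q := hg.hasStrictFDerivAt (by norm_num)
  have hfs : HasStrictFDerivAt f (fderiv ℝ f q) q := hf.hasStrictFDerivAt (by norm_num)
  have hfd : ∀ h, fderiv ℝ f q h = inner ℝ g h := fun h => by
    rw [hgdef, gradient, InnerProductSpace.toDual_symm_apply]
  have hg0 : g ≠ 0 := by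
    intro h0
    exact hf0 (by ext h; rw [hfd, h0]; simp)
  let E := EuclideanSpace ℝ (Fin m)
  -- `A + t • B` is the derivative at `(q, t)` of `(x, s) ↦ (x + s ∇f(x), f x)`; the second
  -- component keeps track of the level set.
  let A : E × ℝ →L[ℝ] E × ℝ :=
    ((ContinuousLinearMap.fst ℝ E ℝ) + (ContinuousLinearMap.snd ℝ E ℝ).smulRight g).prod
      ((fderiv ℝ f q).comp (ContinuousLinearMap.fst ℝ E ℝ))
  let B : E × ℝ →L[ℝ] E × ℝ :=
    (H.comp (ContinuousLinearMap.fst ℝ E ℝ)).prod 0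
  have hA : Function.Injective (A : E × ℝ →ₗ[ℝ] E × ℝ) := by
    rw [injective_iff_map_eq_zero]
    rintro ⟨h, s⟩ hz
    have h1 : h + s • g = 0 := congrArg Prod.fst hz
    have h2 : fderiv ℝ f q h = 0 := congrArg Prod.snd hz
    rw [hfd, eq_neg_of_add_eq_zero_left h1, inner_neg_right, inner_smul_right, neg_eq_zero,
      mul_eq_zero, inner_self_eq_zero] at h2
    have hs : s = 0 := h2.resolve_right hg0
    rw [hs, zero_smul, add_zero] at h1
    rw [h1, hs]; rfl
  refine ⟨_, LinearMap.finite_setOf_not_surjective_add_smul _ (B : E × ℝ →ₗ[ℝ] E × ℝ) hA,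
    fun t ht P hP => ?_⟩
  have hsurj : Function.Surjective (A + t • B) := by
    exact not_not.1 ht
  have hG : HasStrictFDerivAt (fun z : E × ℝ => (z.1 + z.2 • gradient f z.1, f z.1))
      (A + t • B) (q, t) := by
    have hfst : HasStrictFDerivAt (Prod.fst : E × ℝ → E) (ContinuousLinearMap.fst ℝ E ℝ) (q, t) :=
      hasStrictFDerivAt_fst
    have hsnd : HasStrictFDerivAt (Prod.snd : E × ℝ → ℝ) (ContinuousLinearMap.snd ℝ E ℝ) (q, t) :=
      hasStrictFDerivAt_snd
    have h1 : HasStrictFDerivAt (fun z : E × ℝ => gradient f z.1)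
      (H.comp (ContinuousLinearMap.fst ℝ E ℝ)) (q, t) := HasStrictFDerivAt.comp (q, t) hgs hfst
    have h2 : HasStrictFDerivAt (fun z : E × ℝ => f z.1)
      ((fderiv ℝ f q).comp (ContinuousLinearMap.fst ℝ E ℝ)) (q, t) :=
      HasStrictFDerivAt.comp (q, t) hfs hfst
    refine ((hfst.add (hsnd.smul h1)).prodMk h2).congr_fderiv ?_
    ext z <;> simp [A, B, hgdef]
  have hmap := hG.map_nhds_eq_of_surj (LinearMap.range_eq_top.2 hsurj)
  have hev : ∀ᶠ w in 𝓝 ((q + t • g, f q) : E × ℝ), ∃ z : E × ℝ, P z ∧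
      (z.1 + z.2 • gradient f z.1, f z.1) = w := by
    change ∀ᶠ w in 𝓝 ((fun z : E × ℝ => (z.1 + z.2 • gradient f z.1, f z.1)) (q, t)), _
    rw [← hmap, eventually_map]
    filter_upwards [hP] with z hz using ⟨z, hz, rfl⟩
  rw [hfq] at hev
  have hc : Continuous fun p : E => (p, (0 : ℝ)) := by fun_prop
  filter_upwards [(hc.tendsto (q + t • g)).eventually hev] with p hp
  obtain ⟨z, hz, e⟩ := hp
  exact ⟨z, hz, congrArg Prod.snd e, congrArg Prod.fst e⟩

/-- `c` is an incenter of `K`: an interior point at the largest possible distance from the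
boundary, attained at the boundary point `q`. -/
structure IsIncenter (K : Set (EuclideanSpace ℝ (Fin m))) (c q : EuclideanSpace ℝ (Fin m)) :
    Prop where
  mem_interior : c ∈ interior K
  mem_frontier : q ∈ frontier K
  dist_le : ∀ y ∈ frontier K, dist c q ≤ dist c y
  exists_dist_le : ∀ p ∈ K, ∃ y ∈ frontier K, dist p y ≤ dist c q

theorem IsConvexBody.exists_isIncenter (hK : IsConvexBody K) (hf : (frontier K).Nonempty) :
    ∃ c q, IsIncenter K c q := by
  have hfc : IsCompact (frontier K) := hK.isCompact.of_isClosed_subset isClosed_frontier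
    hK.frontier_subset
  have hKne : K.Nonempty := hK.nonempty_interior.mono interior_subset
  obtain ⟨c, hc, hmax⟩ := hK.isCompact.exists_isMaxOn hKne
    (Metric.continuous_infDist_pt (frontier K)).continuousOn
  obtain ⟨q, hq, hcq⟩ := hfc.exists_infDist_eq_dist hf c
  obtain ⟨o, ho⟩ := hK.nonempty_interior
  have hpos : 0 < Metric.infDist c (frontier K) := by
    refine lt_of_lt_of_le ?_ (hmax (interior_subset ho))
    obtain ⟨y, hy, e⟩ := hfc.exists_infDist_eq_dist hf o
    change 0 < Metric.infDist o (frontier K)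
    rw [e]
    exact dist_pos_of_mem_interior_of_mem_frontier ho hy
  refine ⟨c, q, ?_, hq, fun y hy => hcq ▸ Metric.infDist_le_dist_of_mem hy, fun p hp => ?_⟩
  · by_contra hci
    have : c ∈ frontier K := by rw [hK.frontier_eq]; exact ⟨hc, hci⟩
    rw [Metric.infDist_zero_of_mem this] at hpos
    exact hpos.false
  · obtain ⟨y, hy, e⟩ := hfc.exists_infDist_eq_dist hf p
    exact ⟨y, hy, by rw [← e, ← hcq]; exact hmax hp⟩

/-- A normal that is neither the shortest nor the longest through `p₁`, and whose foot is not a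
focal point of `p₁`, persists near `p₁`. -/
theorem IsConvexBody.eventually_three_le_numNormals (hK : IsConvexBody K)
    (hball : ¬ ∃ (c : EuclideanSpace ℝ (Fin m)) (r : ℝ), 0 < r ∧ K = Metric.closedBall c r)
    {p₁ q a₁ b : EuclideanSpace ℝ (Fin m)} {t₁ : ℝ}
    (hf : ContDiffAt ℝ 2 f q) (hf0 : fderiv ℝ f q ≠ 0)
    (hfK : ∀ᶠ x in 𝓝 q, (x ∈ frontier K ↔ f x = 0))
    (hnear : ∀ P : EuclideanSpace ℝ (Fin m) × ℝ → Prop, (∀ᶠ z in 𝓝 (q, t₁), P z) →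
      ∀ᶠ p in 𝓝 p₁, ∃ z, P z ∧ f z.1 = 0 ∧ z.1 + z.2 • gradient f z.1 = p)
    (hsK : p₁ ∈ interior K) (ha₁ : a₁ ∈ frontier K) (hb : b ∈ K)
    (hsa : dist p₁ a₁ < dist p₁ q) (hsb : dist p₁ q < dist p₁ b) :
    ∀ᶠ p in 𝓝 p₁, 3 ≤ numNormals K p := by
  have hcy (y : EuclideanSpace ℝ (Fin m)) : Continuous
      fun w : EuclideanSpace ℝ (Fin m) × EuclideanSpace ℝ (Fin m) => dist w.2 y :=
    continuous_snd.dist continuous_const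
  have hcx : Continuous
      fun w : EuclideanSpace ℝ (Fin m) × EuclideanSpace ℝ (Fin m) => dist w.2 w.1 :=
    continuous_snd.dist continuous_fst
  have hpair : ∀ᶠ w in 𝓝 ((q, p₁) : EuclideanSpace ℝ (Fin m) × EuclideanSpace ℝ (Fin m)),
      dist w.2 a₁ < dist w.2 w.1 ∧ dist w.2 w.1 < dist w.2 b := by
    have h1 := (isOpen_lt (hcy a₁) hcx).mem_nhds (x := (q, p₁)) hsa
    have h2 := (isOpen_lt hcx (hcy b)).mem_nhds (x := (q, p₁)) hsb
    exact Filter.inter_mem h1 h2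
  rw [nhds_prod_eq, eventually_prod_iff] at hpair
  obtain ⟨X, hX, Y, hY, hXY⟩ := hpair
  have hfd : ∀ᶠ x in 𝓝 q, fderiv ℝ f x ≠ 0 :=
    (hf.fderiv_right (m := 1) (by norm_num)).continuousAt.eventually_ne hf0
  have hgood := (hX.and ((hf.eventually (by norm_num)).and (hfd.and hfK.eventually_nhds))).prod_inl_nhds
    t₁
  filter_upwards [hnear _ hgood, hY, isOpen_interior.mem_nhds hsK] with p hp hpY hpK
  obtain ⟨⟨x, t⟩, ⟨hxX, hxf, hx0, hxK⟩, hfx, hpx⟩ := hp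
  have hxfr : x ∈ frontier K := hxK.self_of_nhds.2 hfx
  obtain ⟨u, hu⟩ := hK.exists_isInnerNormalVector hxfr
  obtain ⟨l, -, hl⟩ := hu.exists_gradient_eq_smul hK hxfr
    (hxf.hasStrictFDerivAt (by norm_num)) hx0 hxK
  have hpxu : p - x = (t * l) • u := by
    rw [← hpx, add_sub_cancel_left, hl, smul_smul]
  -- The gradient may point inward or outward; interiority of `p` fixes the sign of `t * l`.
  have hupos := hu.inner_pos_of_mem_interior hpK
  rw [hpxu, inner_smul_right] at hupos
  have htl : 0 < t * l := pos_of_mul_pos_left hupos real_inner_self_nonneg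
  refine hK.three_le_numNormals hball hpK hxfr ⟨?_, fun y hy => ?_⟩ ha₁
    hb (hXY hxX hpY).1 (hXY hxX hpY).2
  · rw [hpxu]; exact smul_ne_zero htl.ne' hu.1
  · rw [hpxu, real_inner_smul_left]; exact mul_nonneg htl.le (hu.2 y hy)


/-- A convex body whose boundary is of class `C²` near a contact point of an inscribed ball of
maximal radius is a ball, or has more than two normals through a point on average. -/
theorem IsIncenter.two_lt_avgNormals {c q : EuclideanSpace ℝ (Fin m)} (hcq : IsIncenter K c q)
    (hK : IsConvexBody K)
    (hball : ¬ ∃ (c : EuclideanSpace ℝ (Fin m)) (r : ℝ), 0 < r ∧ K = Metric.closedBall c r)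
    (hf : ContDiffAt ℝ 2 f q) (hf0 : fderiv ℝ f q ≠ 0)
    (hfK : ∀ᶠ x in 𝓝 q, (x ∈ frontier K ↔ f x = 0)) : 2 < avgNormals K := by
  have hne : (frontier K).Nonempty := ⟨q, hcq.mem_frontier⟩
  have hρ : 0 < dist c q := dist_pos_of_mem_interior_of_mem_frontier hcq.mem_interior
    hcq.mem_frontier
  have hcn : IsInnerNormalVector K q (c - q) :=
    hK.isInnerNormalVector_of_nearest hcq.mem_interior hcq.mem_frontier hcq.dist_le
  obtain ⟨k, hk0, hk⟩ := hcn.exists_gradient_eq_smul hK hcq.mem_frontier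
    (hf.hasStrictFDerivAt (by norm_num)) hf0 hfK
  obtain ⟨S, hS, hnear⟩ := eventually_exists_eq_add_smul_gradient hf hf0
    (hfK.self_of_nhds.1 hcq.mem_frontier)
  obtain ⟨a, b, ha, hb, hlt, -, -⟩ := hK.exists_nearest_farthest hne hball hcq.mem_interior
  have hqb : dist c q < dist c b := (hcq.dist_le a ha.1).trans_lt hlt
  have hline : Continuous fun s : ℝ => q + s • (c - q) := by fun_prop
  have hline1 : Tendsto (fun s : ℝ => q + s • (c - q)) (𝓝[>] 1) (𝓝 c) := by
    simpa using (hline.tendsto 1).mono_left nhdsWithin_le_nhds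
  -- Since `∇f(q) = k (c - q)`, the point at parameter `s` has gradient parameter `s * k⁻¹`.
  have hTfin : ∀ᶠ s in 𝓝[>] (1 : ℝ), s * k⁻¹ ∉ S :=
    ((nhdsWithin_mono 1 fun x (hx : 1 < x) => hx.ne').trans (nhdsNE_le_cofinite 1))
      (hS.preimage (mul_left_injective₀ (inv_ne_zero hk0)).injOn).compl_mem_cofinite
  have hfar : ∀ᶠ p in 𝓝 c, dist p q < dist p b :=
    (show Continuous fun p => dist p q by fun_prop).continuousAt.eventually_lt
      (show Continuous fun p => dist p b by fun_prop).continuousAt hqb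
  obtain ⟨s, hsS, hsb, hsK, hs1⟩ := (hTfin.and ((hline1.eventually hfar).and
    ((hline1.eventually_mem (isOpen_interior.mem_nhds hcq.mem_interior)).and
      self_mem_nhdsWithin))).exists
  set p₁ := q + s • (c - q) with hp₁
  have hs1' : 1 < s := hs1
  have hp₁q : dist p₁ q = s * dist c q := by
    rw [dist_eq_norm, hp₁, add_sub_cancel_left, norm_smul, Real.norm_of_nonneg (by linarith),
      dist_eq_norm]
  obtain ⟨a₁, ha₁, hpa⟩ := hcq.exists_dist_le p₁ (interior_subset hsK)
  -- Maximality of the inradius: `dist p₁ a₁ ≤ dist c q < s * dist c q`.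
  have hsa : dist p₁ a₁ < dist p₁ q := by rw [hp₁q]; nlinarith
  have hpt : q + (s * k⁻¹) • gradient f q = p₁ := by
    rw [hk, smul_smul, mul_assoc, inv_mul_cancel₀ hk0, mul_one]
  have hev := hK.eventually_three_le_numNormals hball hf hf0 hfK
    (fun P hP => hpt ▸ hnear _ hsS P hP) hsK ha₁ (hK.frontier_subset hb.1) hsa hsb
  obtain ⟨O, hOsub, hO, hp₁O⟩ := eventually_nhds_iff.1
    (hev.and (isOpen_interior.mem_nhds hsK))
  exact hK.two_lt_avgNormals (fun p hp => hK.two_le_numNormals hne hball hp) hO ⟨p₁, hp₁O⟩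
    (fun p hp => (hOsub p hp).2) fun p hp => (hOsub p hp).1

end LocallySmooth

/-! ### Flatness of a polytope at a contact point of an inner ball. -/

section Polytope

variable {m : ℕ} {K : Set (EuclideanSpace ℝ (Fin m))}

/-- A supporting hyperplane of `convexHull V` at `x` is spanned near `x` by points of `V`. -/
theorem exists_subset_mem_convexHull_of_isInnerNormalVector {V : Set (EuclideanSpace ℝ (Fin m))}
    {x u : EuclideanSpace ℝ (Fin m)} (hx : x ∈ convexHull ℝ V)
    (hu : IsInnerNormalVector (convexHull ℝ V) x u) :
    ∃ W ⊆ V, x ∈ convexHull ℝ W ∧ ∀ y ∈ convexHull ℝ W, inner ℝ u y = inner ℝ u x := by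
  rw [mem_convexHull_iff_exists_fintype] at hx
  obtain ⟨ι, _, w, z, hw0, hw1, hz, hsum⟩ := hx
  have hnn : ∀ i, 0 ≤ w i * inner ℝ u (z i - x) := fun i =>
    mul_nonneg (hw0 i) (hu.2 _ (subset_convexHull ℝ V (hz i)))
  have htot : ∑ i, w i * inner ℝ u (z i - x) = 0 := by
    simp_rw [← inner_smul_right, ← inner_sum, smul_sub, Finset.sum_sub_distrib, ← Finset.sum_smul,
      hsum, hw1, one_smul, sub_self, inner_zero_right]
  have hzero := (Finset.sum_eq_zero_iff_of_nonneg fun i _ => hnn i).1 htot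
  let W := {v ∈ V | inner ℝ u v = inner ℝ u x}
  refine ⟨W, Set.sep_subset _ _, ?_, ?_⟩
  -- `Convex.finsum_mem` asks for membership only where the weight is nonzero, that is on the face.
  · rw [← hsum, ← finsum_eq_sum_of_fintype]
    refine (convex_convexHull ℝ W).finsum_mem hw0 (by rw [finsum_eq_sum_of_fintype, hw1]) ?_
    intro i hi
    refine subset_convexHull ℝ W ⟨hz i, ?_⟩
    have := (mul_eq_zero.1 (hzero i (Finset.mem_univ i))).resolve_left hi
    rwa [inner_sub_right, sub_eq_zero] at this
  · have hconv : Convex ℝ {y : EuclideanSpace ℝ (Fin m) | inner ℝ u y = inner ℝ u x} :=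
      convex_hyperplane (innerSL ℝ u).isLinear _
    exact fun y hy => convexHull_min (fun v hv => hv.2) hconv hy

/-- Near a contact point of an inner ball, the boundary of a polytope is a hyperplane. -/
theorem IsConvexBody.eventually_mem_frontier_iff_of_isConvexPolytope (hK : IsConvexBody K)
    (hP : IsConvexPolytope K) {c q : EuclideanSpace ℝ (Fin m)} (hc : c ∈ interior K)
    (hq : q ∈ frontier K) (h : ∀ y ∈ frontier K, dist c q ≤ dist c y) :
    ∀ᶠ x in 𝓝 q, (x ∈ frontier K ↔ inner ℝ (c - q) (x - q) = 0) := by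
  obtain ⟨V, hV, rfl⟩ := hP
  have hr : 0 < ‖c - q‖ := by
    rw [← dist_eq_norm]; exact dist_pos_of_mem_interior_of_mem_frontier hc hq
  have hcn := hK.isInnerNormalVector_of_nearest hc hq h
  have hclosed : ∀ W ⊆ V, IsClosed (convexHull ℝ W) := fun W hW =>
    ((hV.subset hW).isCompact_convexHull (𝕜 := ℝ)).isClosed
  -- Finitely many closed hulls: those missing `q` also miss a neighbourhood of it.
  have hfaces : ∀ᶠ x in 𝓝 q, ∀ W ∈ V.powerset, x ∈ convexHull ℝ W → q ∈ convexHull ℝ W := by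
    rw [Filter.eventually_all_finite hV.powerset]
    intro W hW
    by_cases hqW : q ∈ convexHull ℝ W
    · exact Eventually.of_forall fun _ _ => hqW
    · filter_upwards [(hclosed W hW).isOpen_compl.mem_nhds hqW] with x hx hx'
      exact absurd hx' hx
  have hflat : ∀ᶠ x in 𝓝 q, x ∈ frontier (convexHull ℝ V) → inner ℝ (c - q) (x - q) = 0 := by
    filter_upwards [hfaces] with x hx hxf
    obtain ⟨u, hu⟩ := hK.exists_isInnerNormalVector hxf
    obtain ⟨W, hWV, hxW, hW⟩ :=
      exists_subset_mem_convexHull_of_isInnerNormalVector (hK.frontier_subset hxf) hu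
    have hqx : inner ℝ u q = inner ℝ u x := hW q (hx W hWV hxW)
    -- The hyperplane supporting at `x` also supports at `q`, where the inner ball makes the normal
    -- unique.
    have huq : IsInnerNormalVector (convexHull ℝ V) q u := by
      refine ⟨hu.1, fun y hy => ?_⟩
      have := hu.2 y hy
      rwa [inner_sub_right, hqx, ← inner_sub_right]
    have e := huq.smul_eq_of_nearest hK.isCompact.isClosed hc hq h
    have h0 : ‖u‖ * inner ℝ (c - q) (x - q) = 0 := by
      rw [← real_inner_smul_left, ← e, real_inner_smul_left, inner_sub_right, hqx, sub_self,
        mul_zero]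
    exact (mul_eq_zero.1 h0).resolve_left (norm_pos_iff.2 hu.1).ne'
  obtain ⟨ε, hε, hball⟩ := Metric.eventually_nhds_iff_ball.1 hflat
  have hsmall : ∀ᶠ x in 𝓝 q, dist x q < ‖c - q‖ ∧ 2 * dist x q < ε := by
    have hd : Tendsto (fun x => dist x q) (𝓝 q) (𝓝 0) := by
      simpa using (show Continuous fun x => dist x q by fun_prop).tendsto q
    have hd2 : Tendsto (fun x => 2 * dist x q) (𝓝 q) (𝓝 0) := by simpa using hd.const_mul 2
    exact (hd.eventually_lt_const hr).and (hd2.eventually_lt_const hε)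
  filter_upwards [hflat, hsmall] with x hx hxs
  refine ⟨hx, fun hin => ?_⟩
  by_contra hxf
  have hxi : x ∉ interior (convexHull ℝ V) := fun hi => (hcn.inner_pos_of_mem_interior hi).ne' hin
  have hxK : x ∉ convexHull ℝ V := fun hx' => hxf (hK.frontier_eq ▸ ⟨hx', hxi⟩)
  have hxq : x ≠ q := fun e => hxK (e ▸ hK.frontier_subset hq)
  have hd : 0 < dist x q := dist_pos.2 hxq
  -- the point over `x` at height comparable to `dist x q` lies in the inner ball
  let s := dist x q / ‖c - q‖
  have hs : 0 < s := by positivity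
  have hs1 : s < 1 := (div_lt_one hr).2 hxs.1
  have hsr : s * ‖c - q‖ = dist x q := div_mul_cancel₀ _ hr.ne'
  have hyi : x + s • (c - q) ∈ interior (convexHull ℝ V) := by
    refine ball_subset_interior_of_le_dist_frontier hK.isCompact.isClosed hc h ?_
    rw [Metric.mem_ball, dist_eq_norm, dist_eq_norm]
    have e : x + s • (c - q) - c = (x - q) + (s - 1) • (c - q) := by
      rw [sub_smul, one_smul]; abel
    have h1 : ‖x + s • (c - q) - c‖ ^ 2 = (s ^ 2 + (s - 1) ^ 2) * ‖c - q‖ ^ 2 := by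
      rw [e, norm_add_sq_real, inner_smul_right, real_inner_comm, hin, norm_smul, mul_pow,
        ← dist_eq_norm x q, ← hsr, Real.norm_eq_abs, sq_abs]
      ring
    have h2 : (s ^ 2 + (s - 1) ^ 2) * ‖c - q‖ ^ 2 < 1 * ‖c - q‖ ^ 2 := by
      apply mul_lt_mul_of_pos_right _ (by positivity)
      nlinarith
    rw [one_mul, ← h1] at h2
    exact lt_of_pow_lt_pow_left₀ 2 hr.le h2
  -- From `x` outside `K` the segment enters the interior, so it crosses the boundary within `2 *
  -- dist x q` of `q`. There `hflat` forces the crossing to be `x` itself.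
  obtain ⟨z, hz, hzf⟩ : ∃ z ∈ segment ℝ x (x + s • (c - q)), z ∈ frontier (convexHull ℝ V) := by
    by_contra hno
    push Not at hno
    have hsub := (convex_segment (𝕜 := ℝ) x (x + s • (c - q))).isPreconnected.subset_left_of_subset_union
      isOpen_interior hK.isCompact.isClosed.isOpen_compl
      (disjoint_compl_right.mono_left interior_subset) (fun z hz => by
        by_cases hzK : z ∈ convexHull ℝ V
        · left
          by_contra hzi
          exact hno z hz (hK.frontier_eq ▸ ⟨hzK, hzi⟩)
        · exact Or.inr hzK) ⟨_, right_mem_segment ℝ x _, hyi⟩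
    exact hxi (hsub (left_mem_segment ℝ x _))
  rw [segment_eq_image'] at hz
  obtain ⟨θ, ⟨hθ0, hθ1⟩, rfl⟩ := hz
  simp only [add_sub_cancel_left] at hzf
  have hθs : θ * s ≤ s := by nlinarith
  have hzball : x + θ • s • (c - q) ∈ Metric.ball q ε := by
    rw [Metric.mem_ball, dist_eq_norm, add_sub_right_comm]
    refine (norm_add_le _ _).trans_lt (lt_of_le_of_lt ?_ hxs.2)
    rw [smul_smul, norm_smul, Real.norm_of_nonneg (by positivity), ← dist_eq_norm]
    nlinarith
  have h0 := hball _ hzball hzf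
  rw [add_sub_right_comm, inner_add_right, hin, zero_add, inner_smul_right, inner_smul_right,
    real_inner_self_eq_norm_sq] at h0
  have hθ : θ = 0 := by
    have : s * ‖c - q‖ ^ 2 ≠ 0 := by positivity
    exact (mul_eq_zero.1 h0).resolve_right this
  rw [hθ, zero_smul, add_zero] at hzf
  exact hxf hzf

/-- Every point of a sphere is extreme in its ball, while extreme points of `convexHull ℝ V` lie in
the finite set `V`. For `m ≥ 2` the sphere is connected, hence infinite. -/
theorem IsConvexPolytope.ne_closedBall (hm : 2 ≤ m) (hP : IsConvexPolytope K)
    (c : EuclideanSpace ℝ (Fin m)) {r : ℝ} (hr : 0 < r) : K ≠ Metric.closedBall c r := by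
  obtain ⟨V, hV, rfl⟩ := hP
  intro h
  have hrank : 1 < Module.rank ℝ (EuclideanSpace ℝ (Fin m)) := by
    rw [← Module.finrank_eq_rank, finrank_euclideanSpace_fin]
    exact_mod_cast hm
  have : Nontrivial (EuclideanSpace ℝ (Fin m)) :=
    Module.nontrivial_of_finrank_pos (R := ℝ) (by rw [finrank_euclideanSpace_fin]; omega)
  have hfin : (Metric.sphere c r).Finite := by
    refine hV.subset ((StrictConvexSpace.sphere_subset_extremePoints_closedBall c hr.ne').trans ?_)
    rw [← h]
    exact extremePoints_convexHull_subset
  refine (isPreconnected_sphere hrank c r).infinite_of_nontrivial ?_ hfin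
  obtain ⟨v, hv⟩ := exists_norm_eq (EuclideanSpace ℝ (Fin m)) hr.le
  refine ⟨c + v, by simp [hv], c - v, by simp [hv], fun e => ?_⟩
  have hv0 : v = 0 := by
    rw [sub_eq_add_neg] at e
    have h2 : (2 : ℝ) • v = 0 := by
      rw [two_smul]
      exact eq_neg_iff_add_eq_zero.1 (add_left_cancel e)
    exact (smul_eq_zero.1 h2).resolve_left two_ne_zero
  rw [hv0, norm_zero] at hv
  exact hr.ne hv

end Polytope

theorem theorem1 (m : ℕ) :
    (∀ K : Set (EuclideanSpace ℝ (Fin m)), IsConvexBody K → HasC2Boundary K →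
      avgNormals K = 2 →
        ∃ (c : EuclideanSpace ℝ (Fin m)) (r : ℝ), 0 < r ∧ K = Metric.closedBall c r) ∧
    (2 ≤ m → ∀ P : Set (EuclideanSpace ℝ (Fin m)), IsConvexBody P → IsConvexPolytope P →
      2 < avgNormals P) := by
  refine ⟨fun K hK hC2 havg => ?_, fun hm P hP hpoly => ?_⟩
  · by_contra hball
    -- An empty frontier occurs only for `m = 0`; the average is then 0.
    rcases (frontier K).eq_empty_or_nonempty with hf | hf
    · simp [avgNormals, numNormals_eq_zero_of_frontier_eq_empty hf] at havg
    · obtain ⟨c, q, hcq⟩ := hK.exists_isIncenter hf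
      obtain ⟨f, hf2, hf0, hfK⟩ := hC2 q hcq.mem_frontier
      exact (hcq.two_lt_avgNormals hK hball hf2 hf0 hfK).ne' havg
  · have : Nontrivial (EuclideanSpace ℝ (Fin m)) :=
      Module.nontrivial_of_finrank_pos (R := ℝ) (by rw [finrank_euclideanSpace_fin]; omega)
    have hf : (frontier P).Nonempty := by
      refine nonempty_frontier_iff.2 ⟨hP.nonempty_interior.mono interior_subset, ?_⟩
      rintro rfl
      exact noncompact_univ _ hP.isCompact
    obtain ⟨c, q, hcq⟩ := hP.exists_isIncenter hf
    have hloc := hP.eventually_mem_frontier_iff_of_isConvexPolytope hpoly hcq.mem_interior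
      hcq.mem_frontier hcq.dist_le
    have hne : c - q ≠ 0 := sub_ne_zero.2 (dist_pos.1
      (dist_pos_of_mem_interior_of_mem_frontier hcq.mem_interior hcq.mem_frontier))
    have hderiv : HasFDerivAt (fun x => inner ℝ (c - q) (x - q)) (innerSL ℝ (c - q)) q :=
      (innerSL ℝ (c - q)).hasFDerivAt.comp q ((hasFDerivAt_id q).sub_const q)
    refine hcq.two_lt_avgNormals hP (fun ⟨c', r, hr, e⟩ => hpoly.ne_closedBall hm c' hr e)
      (f := fun x => inner ℝ (c - q) (x - q))
      (contDiffAt_const.inner ℝ (contDiffAt_id.sub contDiffAt_const)) (fun h0 => hne ?_) hloc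
    rw [hderiv.fderiv] at h0
    have h1 : inner ℝ (c - q) (c - q) = 0 := congrArg (fun l => l (c - q)) h0
    exact inner_self_eq_zero.1 h1
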